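/- All 2-complexes are combinatorial: the attaching map of each 2-cell is a closed edge path of length $\ge 1$. They may be infinite. A map of 2-complexes is combinatorial if it maps the interior of each cell homeomorphically onto the interior of a cell. If $v$ is a vertex of a 2-complex $X$, the link $lk(v,X)$ is the graph whose vertices are the ends of edges at $v$ and whose edges are the corners of 2-cells at $v$. If both ends of an edge $e$ are at $v$, it gives two vertices $e^+,e^-$ of $lk(v,X)$. In an angled 2-complex each corner $c$ carries a real number $\omega(c)$, its angle (or weight). The weight of an edge path in a link is the sum of the weights of its corners, counted with multiplicity. The curvature of a 2-cell $d$ is $\sum\omega(c_j)-(|\partial d|-2)$, where the sum is over the corners $c_j$ of $d$ and $|\partial d|$ is the length of its boundary path. The complex satisfies the weight test if every 2-cell has curvature $\le 0$ and every (non-trivial, cyclically) reduced cycle $c_1\cdots c_n$ in the link of a vertex satisfies $2-\sum_{i=1}^n\omega(c_i)\le 0$. A spherical diagram over $X$ is a combinatorial map $f\colon S\to X$, where $S$ is the 2-sphere with a combinatorial cell structure. The label of an edge $s$ of $S$ is the edge $f(s)$ of $X$. The edge $s$ is a folding edge if the two 2-cells of $S$ along $s$ are mapped to the same 2-cell of $X$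 as mirror images across $s$ (so the two sides lying on $s$ go to the same side of the same 2-cell). $X$ is DR(2) if it is diagrammatically reducible away from every set $K$ of at most one edge of $X$, that is: every spherical diagram over $X$ that has an edge with label not in $K$ also has a folding edge with label not in $K$. Theorem. Let $X$ be an angled 2-complex with a single vertex $v$, all of whose angles are $\ge 0$. Assume that $X$ satisfies the weight test, and that for every edge $e$ of $X$, every edge path $\alpha$ in $lk(v,X)$ connecting $e^+$ and $e^-$ (if there is one) has weight $\omega(\alpha)\ge 2$. Then $X$ is DR(2). -/

import Mathlib

universe u

/-- An oriented edge over a set `E` of edges: `(e, true)` is `e` with its chosen orientation,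
`(e, false)` is `e` with the opposite orientation. -/
abbrev OEdge (E : Type u) : Type u := E × Bool

namespace OEdge

/-- The same edge with the opposite orientation. -/
def rev {E : Type u} (d : OEdge E) : OEdge E := (d.1, !d.2)

/-- Extension to oriented edges of a map that sends every edge (with its chosen orientation) to an
oriented edge; it commutes with reversal of orientation. -/
def extend {E E₂ : Type*} (g : E → OEdge E₂) (d : OEdge E) : OEdge E₂ :=
  if d.2 then g d.1 else (g d.1).rev

end OEdge

/-- A combinatorial 2-complex: vertices `V`, edges `E` (each with a chosen orientation, from `src`
to `tgt`), and 2-cells `F`. The attaching map of the 2-cell `c` is combinatorial, so it is a closed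
edge path of length `len c ≥ 1`, whose consecutive oriented edges are
`bd c 0, bd c 1, …, bd c (len c - 1)`, with indices read cyclically. No finiteness is required. -/
structure TwoComplex where
  V : Type u
  E : Type u
  F : Type u
  src : E → V
  tgt : E → V
  len : F → ℕ
  len_ne_zero : ∀ c, NeZero (len c)
  bd : (c : F) → ZMod (len c) → OEdge E
  bd_closed : ∀ c i,
    (if (bd c i).2 then tgt (bd c i).1 else src (bd c i).1) =
      (if (bd c (i + 1)).2 then src (bd c (i + 1)).1 else tgt (bd c (i + 1)).1)

namespace TwoComplex

instance (X : TwoComplex.{u}) (c : X.F) : NeZero (X.len c) := X.len_ne_zero c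

/-- The initial vertex of an oriented edge. -/
def init (X : TwoComplex.{u}) (d : OEdge X.E) : X.V := if d.2 then X.src d.1 else X.tgt d.1

/-! ### Links

The vertices of the link `lk(v, X)` are the edge ends at `v`. The end of an edge at `v` is encoded
by the oriented edge that leaves `v` through this end. Thus the two link vertices `e⁺`, `e⁻` coming
from an edge `e` are `(e, true)` and `(e, false)`. The edges of the links are the corners. -/

/-- The sides of the 2-cells: `⟨c, i⟩` is the `i`-th edge occurrence in the boundary of `c`. -/
abbrev Side (X : TwoComplex.{u}) : Type u := Σ c : X.F, ZMod (X.len c)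

/-- The edge of `X` on which a side lies. -/
def Side.edge {X : TwoComplex.{u}} (s : X.Side) : X.E := (X.bd s.1 s.2).1

/-- The corners of the 2-cells: `⟨c, i⟩` is the corner of `c` between its `i`-th side and its
`(i+1)`-st side. -/
abbrev Corner (X : TwoComplex.{u}) : Type u := Σ c : X.F, ZMod (X.len c)

/-- A corner together with a direction in which it is traversed as an edge of the link. -/
abbrev OCorner (X : TwoComplex.{u}) : Type u := X.Corner × Bool

namespace OCorner

/-- The same corner traversed in the opposite direction. -/
def rev {X : TwoComplex.{u}} (o : X.OCorner) : X.OCorner := (o.1, !o.2)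

/-- The link vertex at which an oriented corner starts. The corner `⟨c, i⟩` joins the end of `bd c i`
(left through the reverse of `bd c i`) to the beginning of `bd c (i + 1)`. -/
def start {X : TwoComplex.{u}} (o : X.OCorner) : OEdge X.E :=
  if o.2 then (X.bd o.1.1 o.1.2).rev else X.bd o.1.1 (o.1.2 + 1)

/-- The link vertex at which an oriented corner ends. -/
def finish {X : TwoComplex.{u}} (o : X.OCorner) : OEdge X.E := o.rev.start

end OCorner

/-- `X.IsLinkPath p a b`: the list `p` of oriented corners is an edge path from `a` to `b` in the
link. (Both ends of a corner lie in the link of the same vertex, so the path stays in one link.) -/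
def IsLinkPath (X : TwoComplex.{u}) : List X.OCorner → OEdge X.E → OEdge X.E → Prop
  | [], a, b => a = b
  | o :: p, a, b => o.start = a ∧ X.IsLinkPath p o.finish b

/-- `X.IsReducedCycle v p`: `p` is a nonempty closed edge path in `lk(v, X)` in which no corner is
followed, in the cyclic order, by the same corner in the opposite direction. -/
def IsReducedCycle (X : TwoComplex.{u}) (v : X.V) (p : List X.OCorner) : Prop :=
  p ≠ [] ∧ (∃ a, X.init a = v ∧ X.IsLinkPath p a a) ∧
    p.IsChain (fun o₁ o₂ => o₂ ≠ o₁.rev) ∧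
    ∀ o₁ ∈ p.head?, ∀ o₂ ∈ p.getLast?, o₁ ≠ o₂.rev

/-! ### Angles and the weight test -/

/-- An angle structure (the angles are also called weights). -/
abbrev AngleStructure (X : TwoComplex.{u}) : Type u := X.Corner → ℝ

/-- The weight of an edge path in a link: the sum of the angles of its corners, with
multiplicity. -/
def pathWeight (X : TwoComplex.{u}) (ω : X.AngleStructure) (p : List X.OCorner) : ℝ :=
  (p.map (fun o => ω o.1)).sum

/-- The curvature `∑ ω(c_j) - (|∂d| - 2)` of a 2-cell `d`. -/
noncomputable def cellCurvature (X : TwoComplex.{u}) (ω : X.AngleStructure) (d : X.F) : ℝ :=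
  (∑ i : ZMod (X.len d), ω ⟨d, i⟩) - ((X.len d : ℝ) - 2)

/-- The weight test. -/
def WeightTest (X : TwoComplex.{u}) (ω : X.AngleStructure) : Prop :=
  (∀ d : X.F, X.cellCurvature ω d ≤ 0) ∧
    ∀ (v : X.V) (p : List X.OCorner), X.IsReducedCycle v p → 2 - X.pathWeight ω p ≤ 0

/-! ### Spheres, combinatorial maps, spherical diagrams -/

/-- The link of `v` is a circle: it is a nonempty connected graph in which every vertex has
valency 2 (a loop counts twice). -/
def LinkIsCircle (X : TwoComplex.{u}) (v : X.V) : Prop :=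
  (∃ a, X.init a = v) ∧
    (∀ a b, X.init a = v → X.init b = v → ∃ p, X.IsLinkPath p a b) ∧
    ∀ a, X.init a = v → {o : X.OCorner | o.start = a}.ncard = 2

/-- The complex is a 2-sphere with a combinatorial cell structure: a finite connected complex that
is a closed surface (all vertex links are circles) and has Euler characteristic 2. -/
structure IsSphere (S : TwoComplex.{u}) : Prop where
  finite_V : Finite S.V
  finite_E : Finite S.E
  finite_F : Finite S.F
  connected : ∀ v w : S.V, Relation.EqvGen (fun x y => ∃ e, S.src e = x ∧ S.tgt e = y) v w
  surface : ∀ v : S.V, S.LinkIsCircle v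
  euler : (Nat.card S.V : ℤ) - Nat.card S.E + Nat.card S.F = 2

/-- A combinatorial map: it sends vertices to vertices, edges to edges (possibly reversing the
chosen orientations) and 2-cells homeomorphically to 2-cells. Thus the sides of a 2-cell `c` are
matched by `onSide` with the sides of its image by a rotation (when the boundary of `c` is mapped to
the boundary of the image in its given direction) or by a reflection (when the direction is
reversed). -/
structure CombMap (S : TwoComplex.{0}) (X : TwoComplex.{u}) where
  onV : S.V → X.V
  onE : S.E → OEdge X.E
  onF : S.F → X.F
  onSide : (c : S.F) → ZMod (S.len c) → ZMod (X.len (onF c))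
  init_onE : ∀ d : OEdge S.E, X.init (OEdge.extend onE d) = onV (S.init d)
  len_onF : ∀ c, X.len (onF c) = S.len c
  bd_onF : ∀ c,
    (∀ i, onSide c (i + 1) = onSide c i + 1 ∧
      X.bd (onF c) (onSide c i) = OEdge.extend onE (S.bd c i)) ∨
    (∀ i, onSide c (i + 1) = onSide c i - 1 ∧
      X.bd (onF c) (onSide c i) = (OEdge.extend onE (S.bd c i)).rev)

/-- A spherical diagram over `X`: a combinatorial map from a 2-sphere to `X`. (A sphere has only
finitely many cells, so it is no restriction to take the types of its cells in `Type`.) -/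
structure SphericalDiagram (X : TwoComplex.{u}) where
  S : TwoComplex.{0}
  isSphere : S.IsSphere
  map : CombMap S X

namespace SphericalDiagram

/-- The label of an edge of the sphere: the edge of `X` to which it is mapped. -/
def label {X : TwoComplex.{u}} (f : X.SphericalDiagram) (e : f.S.E) : X.E := (f.map.onE e).1

/-- The side of a 2-cell of `X` to which a side of a 2-cell of the sphere is mapped. -/
def side {X : TwoComplex.{u}} (f : X.SphericalDiagram) (s : f.S.Side) : X.Side :=
  ⟨f.map.onF s.1, f.map.onSide s.1 s.2⟩

/-- A folding edge: the two 2-cells along `e` are mapped to the same 2-cell of `X` as mirror images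
of each other across `e`, that is, the two sides that lie on `e` are mapped to the same side of the
same 2-cell of `X`. Equivalently, the image of the link of an end point of `e` is reducible at
(the end of) `e`. -/
def IsFoldingEdge {X : TwoComplex.{u}} (f : X.SphericalDiagram) (e : f.S.E) : Prop :=
  ∃ s₁ s₂ : f.S.Side, s₁ ≠ s₂ ∧ s₁.edge = e ∧ s₂.edge = e ∧ f.side s₁ = f.side s₂

end SphericalDiagram

/-- `X` is diagrammatically reducible away from (the full subcomplex whose set of edges is) `K`:
every spherical diagram with an edge that is not mapped into `K` has a folding edge that is not
mapped into `K`. -/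
def DRAwayFrom (X : TwoComplex.{u}) (K : Set X.E) : Prop :=
  ∀ f : X.SphericalDiagram, (∃ e, f.label e ∉ K) → ∃ e, f.IsFoldingEdge e ∧ f.label e ∉ K

/-- `X` is DR(`k`): it is diagrammatically reducible away from any set of `k - 1` edges. Smaller sets
of edges are included; this is implied as soon as `X` has at least `k` edges, and makes DR(`k`)
imply DR(`k - 1`) in all cases. -/
def IsDR (X : TwoComplex.{u}) (k : ℕ) : Prop :=
  ∀ K : Finset X.E, K.card + 1 ≤ k → X.DRAwayFrom (K : Set X.E)

end TwoComplex

/-! Suppose that every folding edge of a spherical diagram has its label in a set `K` of at most one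
edge. Pull the angles back to the sphere. Combinatorial Gauss–Bonnet (`gaussBonnet`) says that the
vertex terms `2 - ∑ ω` and the cell curvatures add up to `2χ = 4`. The cells contribute at most 0,
so it suffices that the angles at each vertex sum to at least 2 (`two_le_sum_angles`).

The link of a vertex of the sphere is a circle, and its image in the link of `X` can backtrack only
at ends of the edge in `K`. If it meets no such end, it is a reduced cycle and the weight test
applies. Otherwise read it from such an end and cut it at the backtracks. This leaves a reduced
nonempty path between two ends of one edge. If the ends differ, the hypothesis on paths from `e⁺` to
`e⁻` applies; if they agree, the path contains a reduced cycle. Angles are nonnegative, so discarded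
pieces do no harm (`two_le_of_subsingleton`). -/

/-! ### Reversal of oriented edges and corners. -/

namespace OEdge

@[simp] theorem rev_rev {E : Type u} (d : OEdge E) : d.rev.rev = d := by
  simp [rev]

theorem rev_ne {E : Type u} (d : OEdge E) : d.rev ≠ d := fun h => by
  have := congrArg Prod.snd h
  simp [rev] at this

theorem extend_rev {E E₂ : Type*} (g : E → OEdge E₂) (d : OEdge E) :
    extend g d.rev = (extend g d).rev := by
  obtain ⟨e, b⟩ := d
  cases b <;> simp [extend, rev]

theorem extend_fst {E E₂ : Type*} (g : E → OEdge E₂) (d : OEdge E) :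
    (extend g d).1 = (g d.1).1 := by
  unfold extend
  split <;> rfl

end OEdge

namespace TwoComplex

namespace OCorner

variable {X : TwoComplex.{u}}

@[simp] theorem rev_rev (o : X.OCorner) : o.rev.rev = o := by
  simp [rev]

@[simp] theorem rev_fst (o : X.OCorner) : o.rev.1 = o.1 := rfl

theorem rev_ne (o : X.OCorner) : o.rev ≠ o := fun h => by
  have := congrArg Prod.snd h
  simp [rev] at this

@[simp] theorem start_rev (o : X.OCorner) : o.rev.start = o.finish := rfl

@[simp] theorem finish_rev (o : X.OCorner) : o.rev.finish = o.start := by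
  simp [finish]

theorem rev_injective : Function.Injective (rev : X.OCorner → X.OCorner) :=
  Function.LeftInverse.injective rev_rev

theorem init_finish (o : X.OCorner) : X.init o.finish = X.init o.start := by
  have h := X.bd_closed o.1.1 o.1.2
  have key : X.init (X.bd o.1.1 o.1.2).rev = X.init (X.bd o.1.1 (o.1.2 + 1)) := by
    rw [init, init, ← h]
    cases h' : (X.bd o.1.1 o.1.2).2 <;> simp [OEdge.rev, h']
  obtain ⟨c, b⟩ := o
  cases b
  · exact key
  · exact key.symm

end OCorner

/-! ### Link paths -/

section LinkPath

variable {X : TwoComplex.{u}}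

theorem isLinkPath_append {p q : List X.OCorner} {a c : OEdge X.E} :
    X.IsLinkPath (p ++ q) a c ↔ ∃ b, X.IsLinkPath p a b ∧ X.IsLinkPath q b c := by
  induction p generalizing a with
  | nil => simp [IsLinkPath]
  | cons o p ih => simp [IsLinkPath, ih, and_assoc]

theorem IsLinkPath.reverse {p : List X.OCorner} {a b : OEdge X.E} (h : X.IsLinkPath p a b) :
    X.IsLinkPath (p.map OCorner.rev).reverse b a := by
  induction p generalizing a with
  | nil => exact Eq.symm h
  | cons o p ih =>
    rw [List.map_cons, List.reverse_cons, isLinkPath_append]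
    exact ⟨_, ih h.2, rfl, (OCorner.finish_rev o).trans h.1⟩

theorem pathWeight_append (ω : X.AngleStructure) (p q : List X.OCorner) :
    X.pathWeight ω (p ++ q) = X.pathWeight ω p + X.pathWeight ω q := by
  simp [pathWeight]

theorem pathWeight_cons (ω : X.AngleStructure) (o : X.OCorner) (p : List X.OCorner) :
    X.pathWeight ω (o :: p) = ω o.1 + X.pathWeight ω p := by
  simp [pathWeight]

theorem pathWeight_reverse (ω : X.AngleStructure) (p : List X.OCorner) :
    X.pathWeight ω (p.map OCorner.rev).reverse = X.pathWeight ω p := by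
  simp [pathWeight, List.sum_reverse, Function.comp_def]

theorem pathWeight_nonneg {ω : X.AngleStructure} (hω : ∀ c, 0 ≤ ω c) (p : List X.OCorner) :
    0 ≤ X.pathWeight ω p :=
  List.sum_nonneg fun x hx => by
    obtain ⟨o, -, rfl⟩ := List.mem_map.1 hx
    exact hω o.1

/-- A nontrivial closed path in a link that is reduced, except possibly at its base point, contains
a reduced cycle. -/
theorem WeightTest.two_le_of_closed {ω : X.AngleStructure} (hW : X.WeightTest ω)
    (hω : ∀ c, 0 ≤ ω c) (p : List X.OCorner) {a : OEdge X.E} (hne : p ≠ [])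
    (hp : X.IsLinkPath p a a) (hc : p.IsChain (fun o₁ o₂ => o₂ ≠ o₁.rev)) :
    2 ≤ X.pathWeight ω p := by
  induction hn : p.length using Nat.strong_induction_on generalizing p a with
  | _ n ih =>
  by_cases hcyc : ∀ o₁ ∈ p.head?, ∀ o₂ ∈ p.getLast?, o₁ ≠ o₂.rev
  · linarith [hW.2 (X.init a) p ⟨hne, ⟨a, rfl, hp⟩, hc, hcyc⟩]
  -- The first and last corners are mutually inverse: peel both off and induct on the closed path
  -- between them.
  push Not at hcyc
  obtain ⟨o₁, h₁, o₂, h₂, rfl⟩ := hcyc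
  obtain ⟨q, rfl⟩ : ∃ q, p = o₂.rev :: q := by
    cases p with
    | nil => simp at h₁
    | cons x q => exact ⟨q, by simp_all⟩
  rcases List.eq_nil_or_concat q with rfl | ⟨r, z, rfl⟩
  · simp at h₂
    exact absurd h₂ (OCorner.rev_ne o₂)
  obtain rfl : z = o₂ := by simpa [List.getLast?_cons] using h₂
  rw [List.concat_eq_append] at *
  obtain ⟨-, hp⟩ := hp
  obtain ⟨b, hr, rfl, -⟩ := isLinkPath_append.1 hp
  -- With nothing in between, the path would be `z.rev, z`, which backtracks.
  have hr0 : r ≠ [] := by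
    rintro rfl
    simp at hc
  have := ih r.length (by simp at hn; omega) r hr0 (by simpa using hr)
    (List.isChain_append.1 (List.IsChain.tail hc)).1 rfl
  rw [pathWeight_cons, pathWeight_append]
  linarith [hω z.rev.1, pathWeight_nonneg hω [z]]

/-- A nontrivial path between ends of the same edge that is reduced, except possibly at the ends of
this edge, has weight at least two. -/
theorem WeightTest.two_le_of_subsingleton {ω : X.AngleStructure} (hW : X.WeightTest ω)
    (hω : ∀ c, 0 ≤ ω c)
    (hpath : ∀ (e : X.E) (p : List X.OCorner),
      X.IsLinkPath p (e, true) (e, false) → 2 ≤ X.pathWeight ω p)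
    {K : Set X.E} (hK : K.Subsingleton) (p : List X.OCorner) {a c : OEdge X.E} (hne : p ≠ [])
    (hp : X.IsLinkPath p a c) (ha : a.1 ∈ K) (hc : c.1 ∈ K)
    (hch : p.IsChain (fun o₁ o₂ => o₁.finish.1 ∉ K → o₂ ≠ o₁.rev)) :
    2 ≤ X.pathWeight ω p := by
  induction hn : p.length using Nat.strong_induction_on generalizing p c with
  | _ n ih =>
  by_cases hred : p.IsChain (fun o₁ o₂ => o₂ ≠ o₁.rev)
  · obtain ⟨e, s⟩ := a
    obtain ⟨e', t⟩ := c
    obtain rfl : e = e' := hK ha hc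
    cases s <;> cases t
    · exact hW.two_le_of_closed hω p hne hp hred
    · exact pathWeight_reverse ω p ▸ hpath e _ hp.reverse
    · exact hpath e p hp
    · exact hW.two_le_of_closed hω p hne hp hred
  -- A backtrack can only occur at an end of an edge in `K`, so the prefix up to it is a shorter
  -- path of the same kind.
  rw [List.isChain_iff_forall_rel_of_append_cons_cons] at hred
  push Not at hred
  obtain ⟨x, y, l₁, l₂, rfl, hy⟩ := hred
  have hx : x.finish.1 ∈ K := by
    by_contra hx
    exact List.isChain_iff_forall_rel_of_append_cons_cons.1 hch rfl hx hy
  rw [List.append_cons] at hp hch hn ⊢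
  obtain ⟨b, hp₁, hp₂⟩ := isLinkPath_append.1 hp
  obtain ⟨b', -, -, rfl⟩ := isLinkPath_append.1 hp₁
  have := ih _ (by simp at hn ⊢; omega) (l₁ ++ [x]) (by simp) hp₁ hx
    (List.isChain_append.1 hch).1 rfl
  rw [pathWeight_append]
  linarith [pathWeight_nonneg hω (y :: l₂)]

end LinkPath

/-! ### Rotation around the vertices of a closed surface -/

section Rotation

variable {X : TwoComplex.{u}}

theorem LinkIsCircle.eq_of_start_eq {a : OEdge X.E} (h : X.LinkIsCircle (X.init a))
    {x y z : X.OCorner} (hx : x.start = a) (hy : y.start = a) (hz : z.start = a) (hxy : y ≠ x)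
    (hxz : z ≠ x) : y = z := by
  obtain ⟨s, t, -, hst⟩ := Set.ncard_eq_two.1 (h.2.2 a rfl)
  have hmem : ∀ w : X.OCorner, w.start = a → w = s ∨ w = t := fun w hw => by
    have : w ∈ {o : X.OCorner | o.start = a} := hw
    simpa [hst] using this
  have := hmem x hx
  have := hmem y hy
  have := hmem z hz
  grind

theorem LinkIsCircle.exists_start_eq {a : OEdge X.E} (h : X.LinkIsCircle (X.init a))
    (x : X.OCorner) : ∃ y : X.OCorner, y.start = a ∧ y ≠ x := by
  obtain ⟨s, t, hne, hst⟩ := Set.ncard_eq_two.1 (h.2.2 a rfl)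
  have hs : s ∈ {o : X.OCorner | o.start = a} := by simp [hst]
  have ht : t ∈ {o : X.OCorner | o.start = a} := by simp [hst]
  by_cases hsx : s = x
  · exact ⟨t, ht, fun htx => hne (hsx.trans htx.symm)⟩
  · exact ⟨s, hs, hsx⟩

/-- In a finite complex whose links are circles every oriented corner lies on a reduced cycle in a
link that does not use a corner twice. -/
theorem exists_rotation (hX : ∀ v, X.LinkIsCircle v) [Finite X.OCorner] (o : X.OCorner) :
    ∃ (g : ℕ → X.OCorner) (n : ℕ), 0 < n ∧ g 0 = o ∧ g n = o ∧
      (∀ k, (g (k + 1)).start = (g k).finish ∧ g (k + 1) ≠ (g k).rev) ∧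
      Set.InjOn (fun k => (g k).1) (Set.Iio n) := by
  choose nx hstart hne using fun o : X.OCorner => (hX (X.init o.finish)).exists_start_eq o.rev
  have huniq : ∀ o o' : X.OCorner, o'.start = o.finish → o' ≠ o.rev → nx o = o' :=
    fun o o' h h' => (hX _).eq_of_start_eq (OCorner.start_rev o) (hstart o) h (hne o) h'
  -- If `nx x = nx y`, then `x.rev` and `y.rev` are both the unique other oriented corner starting
  -- at the same link vertex.
  have hinj : Function.Injective nx := fun x y hxy => OCorner.rev_injective <|
    (hX _).eq_of_start_eq (hstart x) (OCorner.start_rev x)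
      ((OCorner.start_rev y).trans ((hstart y).symm.trans (hxy ▸ hstart x)))
      (hne x).symm (hxy ▸ (hne y).symm)
  -- Reversal conjugates `nx` to its inverse: `nx (nx o).rev = o.rev`. Hence `nx^[m + 2] o = o.rev`
  -- would give `nx^[m] (nx o) = (nx o).rev`, and the descent by two ends at `m = 0` or `m = 1`.
  have hrev : ∀ (m : ℕ) (o : X.OCorner), nx^[m] o ≠ o.rev := by
    intro m
    induction m using Nat.twoStepInduction with
    | zero => exact fun o => (OCorner.rev_ne o).symm
    | one => exact hne
    | more m ih _ =>
      intro o h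
      refine ih (nx o) (hinj ?_)
      rw [huniq (nx o).rev o.rev (by simp [hstart]) (by simpa using (hne o).symm), ← h,
        ← Function.iterate_succ_apply, ← Function.iterate_succ_apply' nx]
  have hper := hinj.mem_periodicPts o
  refine ⟨fun k => nx^[k] o, Function.minimalPeriod nx o,
    Function.minimalPeriod_pos_of_mem_periodicPts hper, rfl,
    Function.iterate_minimalPeriod, fun k => ?_, ?_⟩
  · simp only [Function.iterate_succ_apply']
    exact ⟨hstart _, hne _⟩
  -- A repeated corner has the same direction both times, since an orbit never meets a reverse.
  · have key : ∀ j k, j ≤ k → (nx^[j] o).1 = (nx^[k] o).1 → nx^[j] o = nx^[k] o := by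
      intro j k hjk h
      have h' := hrev (k - j) (nx^[j] o)
      rw [← Function.iterate_add_apply, Nat.sub_add_cancel hjk] at h'
      refine Prod.ext h ?_
      by_contra h2
      exact h' (Prod.ext h.symm (Bool.eq_not_iff.2 (Ne.symm h2)))
    intro j hj k hk h
    apply Function.iterate_injOn_Iio_minimalPeriod hj hk
    rcases le_total j k with hjk | hjk
    · exact key j k hjk h
    · exact (key k j hjk h.symm).symm

theorem isLinkPath_map_range (g : ℕ → X.OCorner) (hg : ∀ k, (g (k + 1)).start = (g k).finish)
    (n : ℕ) : X.IsLinkPath ((List.range n).map g) (g 0).start (g n).start := by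
  induction n with
  | zero => rfl
  | succ n ih =>
    rw [List.range_succ, List.map_append, isLinkPath_append]
    exact ⟨_, ih, rfl, (hg n).symm⟩

theorem isChain_map_range {α : Type*} {R : α → α → Prop} (g : ℕ → α)
    (hg : ∀ k, R (g k) (g (k + 1))) (n : ℕ) : ((List.range n).map g).IsChain R := by
  rw [List.isChain_map, List.isChain_range]
  exact fun m _ => hg m

end Rotation

/-! ### The map of corners induced by a combinatorial map -/

namespace OCorner

/-- The side of a 2-cell along which an oriented corner starts. -/
def startSide {X : TwoComplex.{u}} (o : X.OCorner) : X.Side :=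
  if o.2 then ⟨o.1.1, o.1.2⟩ else ⟨o.1.1, o.1.2 + 1⟩

theorem edge_startSide {X : TwoComplex.{u}} (o : X.OCorner) : o.startSide.edge = o.start.1 := by
  obtain ⟨c, b⟩ := o
  cases b <;> rfl

/-- Each side carries one corner at each of its two ends. Corners at opposite ends of a side start
at mutually reverse link vertices, so `h` excludes the mixed case. -/
theorem eq_of_startSide_eq {X : TwoComplex.{u}} {o o' : X.OCorner} (h : o.start = o'.start)
    (hs : o.startSide = o'.startSide) : o = o' := by
  obtain ⟨⟨c, i⟩, b⟩ := o
  obtain ⟨⟨c', i'⟩, b'⟩ := o'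
  have hc : c = c' := by cases b <;> cases b' <;> exact congrArg Sigma.fst hs
  subst hc
  cases b <;> cases b' <;> have hs := eq_of_heq (Sigma.mk.inj hs).2
  · obtain rfl : i = i' := add_right_cancel hs
    rfl
  · subst hs
    exact absurd h.symm (OEdge.rev_ne _)
  · subst hs
    exact absurd h (OEdge.rev_ne _)
  · obtain rfl : i = i' := hs
    rfl

end OCorner

namespace CombMap

variable {S : TwoComplex.{0}} {X : TwoComplex.{u}} (f : CombMap S X)

/-- `f` maps the boundary of the 2-cell `c` to the boundary of its image in the given direction. -/
def Preserves (c : S.F) : Prop :=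
  ∀ i, f.onSide c (i + 1) = f.onSide c i + 1 ∧
    X.bd (f.onF c) (f.onSide c i) = OEdge.extend f.onE (S.bd c i)

theorem of_not_preserves {c : S.F} (h : ¬ f.Preserves c) (i : ZMod (S.len c)) :
    f.onSide c (i + 1) = f.onSide c i - 1 ∧
      X.bd (f.onF c) (f.onSide c i) = (OEdge.extend f.onE (S.bd c i)).rev :=
  (f.bd_onF c).resolve_left h i

open Classical in
/-- The image of a corner. -/
noncomputable def onCorner (c : S.Corner) : X.Corner :=
  ⟨f.onF c.1, f.onSide c.1 (if f.Preserves c.1 then c.2 else c.2 + 1)⟩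

open Classical in
/-- The image of an oriented corner. -/
noncomputable def onOCorner (o : S.OCorner) : X.OCorner :=
  (f.onCorner o.1, if f.Preserves o.1.1 then o.2 else !o.2)

theorem onOCorner_rev (o : S.OCorner) : f.onOCorner o.rev = (f.onOCorner o).rev := by
  unfold onOCorner OCorner.rev
  split <;> rfl

/-- The induced map is a graph map of links. When the boundary is reflected, sides `i` and `i + 1`
go to `j + 1` and `j`; this is why `onCorner` uses the image of side `i + 1` and `onOCorner` flips
the direction. -/
theorem start_onOCorner (o : S.OCorner) :
    (f.onOCorner o).start = OEdge.extend f.onE o.start := by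
  obtain ⟨⟨c, i⟩, b⟩ := o
  by_cases h : f.Preserves c
  · cases b <;> simp only [onOCorner, onCorner, OCorner.start, h, if_true]
    · exact (congrArg _ (h i).1.symm).trans (h _).2
    · exact (congrArg _ (h i).2).trans (OEdge.extend_rev _ _).symm
  · have h' := f.of_not_preserves h
    cases b <;> simp only [onOCorner, onCorner, OCorner.start, h, if_false]
    · exact (congrArg _ (h' (i + 1)).2).trans (OEdge.rev_rev _)
    · have hi : f.onSide c (i + 1) + 1 = f.onSide c i := by rw [(h' i).1, sub_add_cancel]
      exact (congrArg (X.bd (f.onF c)) hi).trans ((h' i).2.trans (OEdge.extend_rev _ _).symm)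

theorem finish_onOCorner (o : S.OCorner) :
    (f.onOCorner o).finish = OEdge.extend f.onE o.finish := by
  rw [← OCorner.start_rev, ← onOCorner_rev, start_onOCorner, OCorner.start_rev]

theorem startSide_onOCorner (o : S.OCorner) :
    (f.onOCorner o).startSide = ⟨f.onF o.startSide.1, f.onSide o.startSide.1 o.startSide.2⟩ := by
  obtain ⟨⟨c, i⟩, b⟩ := o
  by_cases h : f.Preserves c
  · cases b <;> simp only [onOCorner, onCorner, OCorner.startSide, h, if_true]
    · exact congrArg (Sigma.mk (f.onF c)) (h i).1.symm
    · rfl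
  · have h' : f.onSide c (i + 1) + 1 = f.onSide c i := by
      rw [(f.of_not_preserves h i).1, sub_add_cancel]
    cases b <;> simp only [onOCorner, onCorner, OCorner.startSide, h, if_false]
    · rfl
    · exact congrArg (Sigma.mk (f.onF c)) h'

/-- The map is affine with slope the unit `1` or `-1`, hence onto, and both cells have the same
length. -/
theorem onSide_bijective (c : S.F) : Function.Bijective (f.onSide c) := by
  have hlen : X.len (f.onF c) = S.len c := f.len_onF c
  obtain ⟨u, hu, hs⟩ : ∃ u : ZMod (X.len (f.onF c)), IsUnit u ∧
      ∀ i, f.onSide c (i + 1) = f.onSide c i + u := by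
    rcases f.bd_onF c with h | h
    · exact ⟨1, isUnit_one, fun i => (h i).1⟩
    · exact ⟨-1, isUnit_one.neg, fun i => (h i).1.trans (sub_eq_add_neg _ _)⟩
  have hn : ∀ n : ℕ, f.onSide c n = f.onSide c 0 + n * u := by
    intro n
    induction n with
    | zero => simp
    | succ n ih => rw [Nat.cast_succ, hs, ih]; push_cast; ring
  have hsurj : Function.Surjective (f.onSide c) := fun y => by
    obtain ⟨w, hw⟩ := hu.exists_left_inv
    refine ⟨(((y - f.onSide c 0) * w).val : ℕ), ?_⟩
    rw [hn, ZMod.natCast_zmod_val, mul_assoc, hw]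
    ring
  refine (Fintype.bijective_iff_surjective_and_card _).2 ⟨hsurj, ?_⟩
  rw [ZMod.card, ZMod.card, hlen]

theorem sum_onCorner (ω : X.AngleStructure) (c : S.F) :
    ∑ i, ω (f.onCorner ⟨c, i⟩) = ∑ i, ω ⟨f.onF c, i⟩ := by
  by_cases h : f.Preserves c
  · simp only [onCorner, h, if_true]
    exact (f.onSide_bijective c).sum_comp fun i => ω ⟨f.onF c, i⟩
  · simp only [onCorner, h, if_false]
    exact ((f.onSide_bijective c).comp (Equiv.addRight 1).bijective).sum_comp
      fun i => ω ⟨f.onF c, i⟩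

theorem cellCurvature_onCorner (ω : X.AngleStructure) (c : S.F) :
    S.cellCurvature (fun d => ω (f.onCorner d)) c = X.cellCurvature ω (f.onF c) := by
  have hlen : (X.len (f.onF c) : ℝ) = S.len c := congrArg Nat.cast (f.len_onF c)
  rw [cellCurvature, cellCurvature, sum_onCorner, hlen]

end CombMap
/-! ### The combinatorial Gauss–Bonnet theorem -/

section GaussBonnet

/-- The vertex of a 2-complex at which a corner lies. -/
def Corner.vertex {X : TwoComplex.{u}} (c : X.Corner) : X.V :=
  X.init (OCorner.start (c, true))

theorem OCorner.vertex_fst {X : TwoComplex.{u}} (o : X.OCorner) :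
    Corner.vertex o.1 = X.init o.start := by
  obtain ⟨c, b⟩ := o
  cases b
  · exact OCorner.init_finish (c, false)
  · rfl

variable (S : TwoComplex.{u})

/-- Count oriented corners by starting point: there are `2|E|` edge ends, each of valency 2, and
every corner has two directions. -/
theorem card_corner_eq_two_mul [Fintype S.E] [Fintype S.F] (hS : ∀ v, S.LinkIsCircle v) :
    Fintype.card S.Corner = 2 * Fintype.card S.E := by
  classical
  have h : Fintype.card S.OCorner = ∑ a : OEdge S.E, 2 := by
    rw [← Finset.card_univ, Finset.card_eq_sum_card_fiberwise
      (f := OCorner.start) (t := Finset.univ) (fun _ _ => Finset.mem_coe.2 (Finset.mem_univ _))]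
    refine Finset.sum_congr rfl fun a _ => ?_
    rw [← (hS (S.init a)).2.2 a rfl, Set.ncard_eq_toFinset_card']
    congr 1
    ext o
    simp
  have h₁ : Fintype.card S.OCorner = Fintype.card S.Corner * 2 := by
    rw [Fintype.card_prod, Fintype.card_bool]
  have h₂ : ∑ a : OEdge S.E, 2 = Fintype.card S.E * 2 * 2 := by
    rw [Finset.sum_const, smul_eq_mul, Finset.card_univ, Fintype.card_prod, Fintype.card_bool]
  omega

-- Each angle occurs once at its vertex and once in its cell, with opposite signs. What remains is
-- `2|V| + 2|F|` minus the total length of the cell boundaries, which is `2|E|`.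
open Classical in
theorem gaussBonnet [Fintype S.V] [Fintype S.E] [Fintype S.F] (hS : ∀ v, S.LinkIsCircle v)
    (ω : S.AngleStructure) :
    ∑ v, (2 - ∑ c with Corner.vertex c = v, ω c) + ∑ d, S.cellCurvature ω d =
      2 * (Fintype.card S.V - Fintype.card S.E + Fintype.card S.F) := by
  have h₁ : ∑ v, ∑ c with Corner.vertex c = v, ω c = ∑ c, ω c :=
    Finset.sum_fiberwise _ _ _
  have h₂ : ∑ d, ∑ i, ω ⟨d, i⟩ = ∑ c, ω c := (Fintype.sum_sigma _).symm
  have h₃ : ∑ d, (S.len d : ℝ) = 2 * Fintype.card S.E := by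
    have := S.card_corner_eq_two_mul hS
    rw [Fintype.card_sigma] at this
    simp only [ZMod.card] at this
    exact_mod_cast this
  simp only [cellCurvature, Finset.sum_sub_distrib, h₁, h₂, h₃, Finset.sum_const,
    Finset.card_univ, nsmul_eq_mul]
  ring

end GaussBonnet

/-! ### Spherical diagrams -/

namespace SphericalDiagram

variable {X : TwoComplex.{u}} (f : X.SphericalDiagram)

/-- Backtracking of the image of a link at an edge end forces a fold: the distinct sides along which
the two corners start have the same image. -/
theorem isFoldingEdge_of_onOCorner_eq {o o' : f.S.OCorner} (hne : o ≠ o')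
    (hs : o.start = o'.start) (h : f.map.onOCorner o = f.map.onOCorner o') :
    f.IsFoldingEdge o.start.1 := by
  refine ⟨o.startSide, o'.startSide, fun h' => hne (OCorner.eq_of_startSide_eq hs h'),
    o.edge_startSide, hs ▸ o'.edge_startSide, ?_⟩
  have := congrArg OCorner.startSide h
  rwa [f.map.startSide_onOCorner, f.map.startSide_onOCorner] at this

open Classical in
theorem two_le_sum_angles [Fintype f.S.Corner] {ω : X.AngleStructure} (hω : ∀ c, 0 ≤ ω c)
    (hW : X.WeightTest ω)
    (hpath : ∀ (e : X.E) (p : List X.OCorner),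
      X.IsLinkPath p (e, true) (e, false) → 2 ≤ X.pathWeight ω p)
    {K : Set X.E} (hK : K.Subsingleton) (hf : ∀ e, f.IsFoldingEdge e → f.label e ∈ K) (v : f.S.V) :
    2 ≤ ∑ c with Corner.vertex c = v, ω (f.map.onCorner c) := by
  have hS := f.isSphere.surface
  -- Start the rotation at an end with label in `K` if there is one, so that the image path begins
  -- and ends there.
  obtain ⟨o, hov, ho⟩ : ∃ o : f.S.OCorner, f.S.init o.start = v ∧
      ((f.map.onOCorner o).start.1 ∈ K ∨
        ∀ o' : f.S.OCorner, f.S.init o'.start = v → (f.map.onOCorner o').start.1 ∉ K) := by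
    by_cases h : ∃ o : f.S.OCorner, f.S.init o.start = v ∧ (f.map.onOCorner o).start.1 ∈ K
    · obtain ⟨o, hov, ho⟩ := h
      exact ⟨o, hov, .inl ho⟩
    · obtain ⟨a, rfl⟩ := (hS v).1
      obtain ⟨o, ho⟩ := Set.nonempty_of_ncard_ne_zero (((hS _).2.2 a rfl).trans_ne two_ne_zero)
      exact ⟨o, congrArg _ ho, .inr fun o' h' hK => h ⟨o', h', hK⟩⟩
  have : Finite f.S.OCorner := inferInstance
  obtain ⟨g, n, hn, hg0, hgn, hg, hinj⟩ := exists_rotation hS o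
  have hgv : ∀ k, f.S.init (g k).start = v := by
    intro k
    induction k with
    | zero => rwa [hg0]
    | succ k ih => rw [(hg k).1, OCorner.init_finish, ih]
  set φ : ℕ → X.OCorner := fun k => f.map.onOCorner (g k) with hφ
  have hφs : ∀ k, (φ (k + 1)).start = (φ k).finish := fun k => by
    rw [hφ, f.map.start_onOCorner, f.map.finish_onOCorner, (hg k).1]
  have hφr : ∀ k, (φ k).finish.1 ∉ K → φ (k + 1) ≠ (φ k).rev := by
    intro k hk h
    refine hk ?_
    rw [hφ, ← f.map.onOCorner_rev] at h
    have := hf _ (f.isFoldingEdge_of_onOCorner_eq (hg k).2 (hg k).1 h)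
    rwa [hφ, f.map.finish_onOCorner, OEdge.extend_fst, ← (hg k).1]
  have hlen : (List.range n).map φ ≠ [] := by simpa using hn.ne'
  have hpathφ := isLinkPath_map_range φ hφs n
  have hloop : (φ n).start = (φ 0).start := by simp only [hφ, hgn, hg0]
  rw [hloop] at hpathφ
  have key : 2 ≤ X.pathWeight ω ((List.range n).map φ) := by
    rcases ho with ho | ho
    · have hb : (φ 0).start.1 ∈ K := by simpa only [hφ, hg0] using ho
      exact hW.two_le_of_subsingleton hω hpath hK _ hlen hpathφ hb hb
        (isChain_map_range φ hφr n)
    · have hred : ∀ k, φ (k + 1) ≠ (φ k).rev := fun k =>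
        hφr k (hφs k ▸ ho _ (hgv (k + 1)))
      refine le_of_sub_nonpos (hW.2 _ _ ⟨hlen, ⟨_, rfl, hpathφ⟩, isChain_map_range φ hred n, ?_⟩)
      -- Reducedness where the cycle closes up is the step from `φ m` to `φ (m + 1) = φ 0`.
      obtain ⟨m, rfl⟩ := Nat.exists_eq_succ_of_ne_zero hn.ne'
      intro o₁ h₁ o₂ h₂
      have h₁ : φ 0 = o₁ := by simpa [List.head?_range] using h₁
      have h₂ : φ m = o₂ := by simpa [List.getLast?_range] using h₂
      have h₃ : φ (m + 1) = φ 0 := congrArg f.map.onOCorner (hgn.trans hg0.symm)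
      rw [← h₁, ← h₂, ← h₃]
      exact hred m
  refine key.trans ?_
  have hsum : X.pathWeight ω ((List.range n).map φ) =
      ∑ c ∈ (Finset.range n).image fun k => (g k).1, ω (f.map.onCorner c) := by
    rw [Finset.sum_image (by simpa using hinj), pathWeight, List.map_map]
    rfl
  rw [hsum]
  -- It is enough that the rotation uses only corners at `v`; any others would add nonnegative
  -- angles.
  refine Finset.sum_le_sum_of_subset_of_nonneg (fun c hc => ?_) fun c _ _ => hω _
  obtain ⟨k, -, rfl⟩ := Finset.mem_image.1 hc
  simp [OCorner.vertex_fst, hgv]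

end SphericalDiagram

/-- Without a fold outside `K`, all terms of Gauss–Bonnet are at most 0, yet their sum is 4. -/
theorem WeightTest.drAwayFrom {X : TwoComplex.{u}} {ω : X.AngleStructure} (hω : ∀ c, 0 ≤ ω c)
    (hW : X.WeightTest ω)
    (hpath : ∀ (e : X.E) (p : List X.OCorner),
      X.IsLinkPath p (e, true) (e, false) → 2 ≤ X.pathWeight ω p)
    {K : Set X.E} (hK : K.Subsingleton) : X.DRAwayFrom K := by
  intro f _
  by_contra! hf
  have := f.isSphere.finite_V
  have := f.isSphere.finite_E
  have := f.isSphere.finite_F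
  have := Fintype.ofFinite f.S.V
  have := Fintype.ofFinite f.S.E
  have := Fintype.ofFinite f.S.F
  have hGB := f.S.gaussBonnet f.isSphere.surface fun c => ω (f.map.onCorner c)
  have hχ : (Fintype.card f.S.V - Fintype.card f.S.E + Fintype.card f.S.F : ℝ) = 2 := by
    have := f.isSphere.euler
    simp only [Nat.card_eq_fintype_card] at this
    exact_mod_cast this
  rw [hχ] at hGB
  have hV := Finset.sum_nonpos fun v (_ : v ∈ Finset.univ) =>
    sub_nonpos.2 (f.two_le_sum_angles hω hW hpath hK hf v)
  have hF := Finset.sum_nonpos fun d (_ : d ∈ Finset.univ) =>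
    (f.map.cellCurvature_onCorner ω d).trans_le (hW.1 (f.map.onF d))
  linarith

end TwoComplex

theorem mainTheorem8 (X : TwoComplex.{u}) (v : X.V) (hv : ∀ w : X.V, w = v)
    (ω : X.AngleStructure) (hω : ∀ c : X.Corner, 0 ≤ ω c) (hW : X.WeightTest ω)
    (hpath : ∀ (e : X.E) (p : List X.OCorner),
      X.IsLinkPath p (e, true) (e, false) → 2 ≤ X.pathWeight ω p) :
    X.IsDR 2 := by
  intro K hK
  exact hW.drAwayFrom hω hpath (Finset.card_le_one_iff_subsingleton.1 (by omega))
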